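/- Let $p$ be a prime, let $K$ be a field of characteristic $p$, and let $L/K$ be a finite purely inseparable field extension of exponent $e$, i.e. $e\ge 0$ is the least integer with $L^{p^e}\subseteq K$, where $L^{p^j}=\{x^{p^j}:x\in L\}$. For $n\ge 0$ let $\mathrm{Diff}^{\,n}_K L$ be the $L$-vector space of differential operators of $L/K$ of order $\le n$, that is, of the $K$-linear maps $D:L\to L$ of the form $D(b)=u(\overline{1\otimes b})$ for some $L$-linear map $u:(L\otimes_K L)/I^{n+1}\to L$, where $I$ is the kernel of the multiplication $L\otimes_K L\to L$ and $L$ acts on the left tensor factor. For $i\ge 0$ set $$\mathcal{A}_{i}=\{D\in \mathrm{Diff}^{\,p^i}_K L:\ D(L^{p^j})\subseteq L^{p^j}\text{ for all } 0\le j\le i\},$$ an $L^{p^i}$-subspace of $\mathrm{Diff}^{\,p^i}_K L$. Call $L/K$ modular if there are finitely many $x_1,\dots,x_n\in L$ with $L\cong K(x_1)\otimes_K\cdots\otimes_K K(x_n)$ as $K$-algebras. Then $L/K$ is modular if and only if, for all integers $i$ with $0<i\le e-1$, the multiplication homomorphism $$L\otimes_{L^{p^i}}\mathcal{A}_{i}\to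 \mathrm{Diff}^{\,p^i}_K L,\qquad b\otimes D\mapsto bD,$$ is surjective. Moreover, for each such $i$, this map is surjective if and only if $\mathcal{A}_{i}$ spans $\mathrm{Diff}^{\,p^i}_K L$ as an $L$-vector space. -/

import Mathlib

open scoped TensorProduct

/-- The module of differential operators of order `≤ n` of the commutative `A`-algebra `B`:
the `A`-linear maps `D : B → B` which factor as `D = u ∘ d`, where `u` is a `B`-linear map on the
`n`-th module of principal parts `(B ⊗[A] B) / I ^ (n + 1)`, with `I` the ideal of the diagonal
(the kernel of the multiplication `B ⊗[A] B → B`) and with `B` acting on the left tensor factor,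
and where `d b` is the class of `1 ⊗ b`. It is a `B`-module for `(b • D) x = b * D x`. -/
def diffOp (A B : Type*) [CommRing A] [CommRing B] [Algebra A B] (n : ℕ) :
    Submodule B (B →ₗ[A] B) where
  carrier := {D | ∃ u : ((B ⊗[A] B) ⧸ (KaehlerDifferential.ideal A B) ^ (n + 1)) →ₗ[B] B,
    ∀ b : B, u (Ideal.Quotient.mk _ (1 ⊗ₜ[A] b)) = D b}
  add_mem' := by
    rintro D E ⟨u, hu⟩ ⟨v, hv⟩
    exact ⟨u + v, fun b => by simp [hu, hv]⟩
  zero_mem' := ⟨0, fun b => by simp⟩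
  smul_mem' := by
    rintro c D ⟨u, hu⟩
    exact ⟨c • u, fun b => by simp [hu]⟩

/-- `B ^ (p ^ j)`: the subring of `p ^ j`-th powers in a commutative ring `B` of prime
characteristic `p`. -/
def frobPow (B : Type*) [CommRing B] (p : ℕ) [ExpChar B p] (j : ℕ) : Subring B :=
  (iterateFrobenius B p j).range

theorem mem_frobPow {B : Type*} [CommRing B] {p : ℕ} [ExpChar B p] {j : ℕ} {x : B} :
    x ∈ frobPow B p j ↔ ∃ y : B, y ^ p ^ j = x := by
  simp [frobPow, iterateFrobenius_def]

theorem frobPow_anti {B : Type*} [CommRing B] {p : ℕ} [ExpChar B p] {i j : ℕ} (h : j ≤ i) :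
    frobPow B p i ≤ frobPow B p j := by
  intro x hx
  obtain ⟨y, rfl⟩ := mem_frobPow.1 hx
  refine mem_frobPow.2 ⟨y ^ p ^ (i - j), ?_⟩
  rw [← pow_mul, ← pow_add, Nat.sub_add_cancel h]

/-- `𝒜_{B/A, i}`: the differential operators of order `≤ p ^ i` of `B/A` which map
`B ^ (p ^ j)` into `B ^ (p ^ j)` for all `j ≤ i`, as a `B ^ (p ^ i)`-submodule of the differential
operators of order `≤ p ^ i`. -/
def frobDiffOp (A B : Type*) [CommRing A] [CommRing B] [Algebra A B] (p : ℕ) [ExpChar B p]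
    (i : ℕ) : Submodule (frobPow B p i) (diffOp A B (p ^ i)) where
  carrier := {D | ∀ j ≤ i, ∀ x ∈ frobPow B p j, (D : B →ₗ[A] B) x ∈ frobPow B p j}
  add_mem' := fun hD hE j hj x hx => add_mem (hD j hj x hx) (hE j hj x hx)
  zero_mem' := fun j _ _ _ => zero_mem (frobPow B p j)
  smul_mem' := fun c _ hD j hj x hx => mul_mem (frobPow_anti hj c.2) (hD j hj x hx)

/-- The multiplication homomorphism `B ⊗ 𝒜_{B/A, i} → Diff^{p ^ i}_A B`, `b ⊗ D ↦ b • D`, the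
tensor product being over `B ^ (p ^ i)`. -/
noncomputable def frobDiffOpMul (A B : Type*) [CommRing A] [CommRing B] [Algebra A B] (p : ℕ)
    [ExpChar B p] (i : ℕ) :
    B ⊗[frobPow B p i] (frobDiffOp A B p i) →ₗ[B] diffOp A B (p ^ i) :=
  (frobDiffOp A B p i).subtype.liftBaseChange B

/-- A field extension `L/K` is modular if there are finitely many `x₁, …, xₙ` in `L` such that
`L` is isomorphic as a `K`-algebra to `K(x₁) ⊗ ⋯ ⊗ K(xₙ)`, the tensor product being over `K`. -/
def IsModularExtension (K L : Type*) [Field K] [Field L] [Algebra K L] : Prop :=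
  ∃ (n : ℕ) (x : Fin n → L),
    Nonempty ((⨂[K] k : Fin n, IntermediateField.adjoin K {x k}) ≃ₐ[K] L)

/-! ### Surjectivity as spanning, and modularity as a degree count -/

open Module IntermediateField

/-! If `L` is a tensor product of simple extensions `K(xₖ)`, the monomials of small multidegree in
`1 ⊗ xₖ - xₖ ⊗ 1` form an `L`-basis of `L ⊗[K] L` adapted to the powers of `I`. The coordinates of
`1 ⊗ a` are Taylor coefficients of `a`, and they span the differential operators of each order. The
`p ^ j`-th power of a basis monomial is a basis monomial or zero, so the Taylor coefficients
preserve `p ^ j`-th powers (`taylorCoeff_mem_frobPow`).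

Conversely, only `i = e - 1` is needed. The operators in `𝒜ᵢ` preserve each `L ^ (p ^ j)` with `j ≤
i`, and spanning gives them the same constants (`D y = D 1 * y`) as all operators of order `≤ p ^ (e
- 1)`. These constants are just `K` (`exists_diffOp_apply_ne`): for `y` outside `K`, a deformation
`L → Ω[X] / (X ^ p ^ (m + 1))` with `y ↦ y + X ^ p ^ m`, `m < e`, yields by taking a coefficient an
operator for which `y` is not constant. A shortest-relation argument in the style of Artin then
makes `K` and `L ^ (p ^ j)` linearly disjoint over their intersection (`mem_closure_of_mem_span`),
and Sweedler's criterion (`isModularExtension_of_mem_closure`) constructs the generators. -/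

theorem frobDiffOpMul_surjective_iff (A B : Type*) [CommRing A] [CommRing B] [Algebra A B] (p : ℕ)
    [ExpChar B p] (i : ℕ) :
    Function.Surjective (frobDiffOpMul A B p i) ↔
      Submodule.span B (frobDiffOp A B p i : Set (diffOp A B (p ^ i))) = ⊤ := by
  rw [← LinearMap.range_eq_top, frobDiffOpMul, LinearMap.range_liftBaseChange]
  simp

/-- Multiplication out of the tensor product is onto when the `x k` generate, so equal dimensions
make it bijective. -/
theorem isModularExtension_iff (K L : Type*) [Field K] [Field L] [Algebra K L]
    [FiniteDimensional K L] :
    IsModularExtension K L ↔ ∃ (n : ℕ) (x : Fin n → L), adjoin K (Set.range x) = ⊤ ∧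
      ∏ k, finrank K K⟮x k⟯ = finrank K L := by
  have hfin {n : ℕ} (x : Fin n → L) :
      finrank K (⨂[K] k, K⟮x k⟯) = ∏ k, finrank K K⟮x k⟯ := by
    rw [finrank_eq_card_basis (Basis.piTensorProduct fun k => finBasis K K⟮x k⟯)]
    simp
  constructor
  · rintro ⟨n, x, ⟨e⟩⟩
    -- The given isomorphism is arbitrary, so the original `x k` need not generate `L`; their images
    -- under it do, with the same minimal polynomials.
    let f (k : Fin n) : K⟮x k⟯ →ₐ[K] L :=
      e.toAlgHom.comp (PiTensorProduct.singleAlgHom (R := K) (A := fun k => K⟮x k⟯) k)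
    refine ⟨n, fun k => f k (AdjoinSimple.gen K (x k)), ?_, ?_⟩
    · rw [eq_top_iff]
      rintro z -
      obtain ⟨w, rfl⟩ := e.surjective z
      have hf (k : Fin n) (a : K⟮x k⟯) :
          f k a ∈ adjoin K (Set.range fun k => f k (AdjoinSimple.gen K (x k))) := by
        obtain ⟨P, rfl⟩ := (adjoin.powerBasis
          (Algebra.IsIntegral.isIntegral (R := K) (x k))).exists_eq_aeval' a
        rw [← Polynomial.aeval_algHom_apply, adjoin.powerBasis_gen]
        exact adjoin_le_iff.2 (Set.singleton_subset_iff.2 (subset_adjoin K _ (Set.mem_range_self k)))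
          (algebra_adjoin_le_adjoin K _ (Polynomial.aeval_mem_adjoin_singleton K _))
      induction w using PiTensorProduct.induction_on with
      | smul_tprod r a =>
        rw [map_smul]
        refine IntermediateField.smul_mem _ ?_
        have : PiTensorProduct.tprod K a =
            ∏ k, PiTensorProduct.singleAlgHom (R := K) (A := fun k => K⟮x k⟯) k (a k) := by
          simp only [PiTensorProduct.singleAlgHom_apply, MonoidHom.mulSingle_apply,
            ← PiTensorProduct.tprod_prod, Finset.univ_prod_mulSingle]
        rw [this, map_prod]
        exact prod_mem fun k _ => hf k (a k)
      | add a b ha hb => rw [map_add]; exact add_mem ha hb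
    · rw [← e.toLinearEquiv.finrank_eq, hfin]
      refine Finset.prod_congr rfl fun k _ => ?_
      rw [adjoin.finrank (Algebra.IsIntegral.isIntegral _),
        adjoin.finrank (Algebra.IsIntegral.isIntegral _), minpoly.algHom_eq _ (f k).injective,
        minpoly_gen]
  · rintro ⟨n, x, hx, hd⟩
    obtain ⟨g, hg⟩ : ∃ g : (⨂[K] k, K⟮x k⟯) →ₐ[K] L,
        ∀ a, g (PiTensorProduct.tprod K a) = ∏ k, (a k : L) := by
      refine ⟨PiTensorProduct.liftAlgHom ((MultilinearMap.mkPiAlgebra K (Fin n) L).compLinearMap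
        fun k => K⟮x k⟯.val.toLinearMap) ?_ ?_, fun a => ?_⟩
      · simp
      · simp [Finset.prod_mul_distrib]
      · exact PiTensorProduct.lift.tprod a
    have hs : Function.Surjective g := by
      have : g.range = ⊤ := by
        rw [eq_top_iff, ← top_toSubalgebra, ← hx, 
          adjoin_toSubalgebra_of_isAlgebraic fun _ _ => Algebra.IsAlgebraic.isAlgebraic _,
          Algebra.adjoin_le_iff]
        rintro _ ⟨k, rfl⟩
        refine ⟨PiTensorProduct.singleAlgHom k (AdjoinSimple.gen K (x k)), ?_⟩
        change g _ = x k
        rw [PiTensorProduct.singleAlgHom_apply, MonoidHom.mulSingle_apply, hg]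
        rw [Finset.prod_eq_single k (fun j _ hj => by simp [hj]) (by simp)]
        simp
      exact AlgHom.range_eq_top g |>.1 this
    refine ⟨n, x, ⟨AlgEquiv.ofBijective g ⟨?_, hs⟩⟩⟩
    have : FiniteDimensional K (⨂[K] k, K⟮x k⟯) := inferInstance
    exact (LinearMap.injective_iff_surjective_of_finrank_eq_finrank ((hfin x).trans hd)
      (f := g.toLinearMap)).2 hs

/-! ### Taylor monomials in `L ⊗[K] L` -/

section Taylor

variable {K L : Type*} [Field K] [Field L] [Algebra K L] {n : ℕ} (x : Fin n → L)

/-- The product of the powers `(1 ⊗ xₖ - xₖ ⊗ 1) ^ βₖ` in `L ⊗[K] L`. -/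
noncomputable def taylorMonomial (K : Type*) [Field K] [Algebra K L] (β : Fin n → ℕ) : L ⊗[K] L :=
  ∏ k, (1 ⊗ₜ[K] x k - x k ⊗ₜ[K] 1) ^ β k

/-- The `L`-span of the monomials of degree at least `m` in the elements
`1 ⊗ xₖ - xₖ ⊗ 1` of `L ⊗[K] L`. -/
noncomputable def taylorFiltration (K : Type*) [Field K] [Algebra K L] (m : ℕ) :
    Submodule L (L ⊗[K] L) :=
  Submodule.span L (taylorMonomial x K '' {β | m ≤ ∑ k, β k})

theorem taylorMonomial_mul (α β : Fin n → ℕ) :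
    taylorMonomial x K α * taylorMonomial x K β = taylorMonomial x K (α + β) := by
  simp [taylorMonomial, pow_add, Finset.prod_mul_distrib]

theorem taylorMonomial_pow (β : Fin n → ℕ) (m : ℕ) :
    taylorMonomial x K β ^ m = taylorMonomial x K (fun k => β k * m) := by
  simp [taylorMonomial, pow_mul, Finset.prod_pow]

theorem taylorMonomial_zero : taylorMonomial x K 0 = 1 := by
  simp [taylorMonomial]

theorem taylorMonomial_single (k : Fin n) :
    taylorMonomial x K (Pi.single k 1) = 1 ⊗ₜ[K] x k - x k ⊗ₜ[K] 1 := by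
  rw [taylorMonomial, Finset.prod_eq_single k (fun j _ hj => by simp [hj]) (by simp)]
  simp

theorem mul_mem_taylorFiltration {a b : ℕ} {y z : L ⊗[K] L} (hy : y ∈ taylorFiltration x K a)
    (hz : z ∈ taylorFiltration x K b) : y * z ∈ taylorFiltration x K (a + b) := by
  have := Submodule.mul_mem_mul hy hz
  rw [taylorFiltration, taylorFiltration, Submodule.span_mul_span] at this
  refine Submodule.span_mono ?_ this
  rintro _ ⟨_, ⟨α, hα, rfl⟩, _, ⟨β, hβ, rfl⟩, rfl⟩
  refine ⟨α + β, ?_, (taylorMonomial_mul x α β).symm⟩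
  simp only [Set.mem_ofPred_eq, Pi.add_apply, Finset.sum_add_distrib] at *
  omega

theorem taylorFiltration_zero_eq_top [FiniteDimensional K L]
    (hx : adjoin K (Set.range x) = ⊤) : taylorFiltration x K 0 = ⊤ := by
  let S : Subalgebra L (L ⊗[K] L) := (taylorFiltration x K 0).toSubalgebra
    (Submodule.subset_span ⟨0, by simp, taylorMonomial_zero x⟩)
    fun a b ha hb => by simpa using mul_mem_taylorFiltration x ha hb
  have hS (b : L) : 1 ⊗ₜ[K] b ∈ S := by
    let R : Subalgebra K L := (S.restrictScalars K).comap Algebra.TensorProduct.includeRight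
    have : R = ⊤ := by
      rw [eq_top_iff, ← top_toSubalgebra, ← hx,
        adjoin_toSubalgebra_of_isAlgebraic fun _ _ => Algebra.IsAlgebraic.isAlgebraic _,
        Algebra.adjoin_le_iff]
      rintro _ ⟨k, rfl⟩
      change 1 ⊗ₜ[K] x k ∈ S
      rw [← sub_add_cancel (1 ⊗ₜ[K] x k) (x k ⊗ₜ[K] 1)]
      refine add_mem ?_ (S.algebraMap_mem (x k))
      rw [← taylorMonomial_single]
      exact Submodule.subset_span ⟨_, by simp, rfl⟩
    exact (this ▸ Algebra.mem_top : b ∈ R)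
  rw [eq_top_iff]
  rintro z -
  induction z using TensorProduct.induction_on with
  | zero => exact zero_mem _
  | tmul a b =>
    have := S.smul_mem (hS b) a
    rw [TensorProduct.smul_tmul', smul_eq_mul, mul_one] at this
    exact this
  | add a b ha hb => exact add_mem ha hb

theorem taylorMonomial_mem_ideal_pow (β : Fin n → ℕ) :
    taylorMonomial x K β ∈ KaehlerDifferential.ideal K L ^ ∑ k, β k := by
  rw [taylorMonomial, ← Finset.prod_pow_eq_pow_sum]
  exact Ideal.prod_mem_prod fun k _ =>
    Ideal.pow_mem_pow (by simp [KaehlerDifferential.ideal, RingHom.mem_ker]) _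

/-- Monomials of positive degree already lie in the ideal, and the only other one is `1`;
multiplication sends `c • 1` to `c`, so `c = 0`. -/
theorem ideal_le_taylorFiltration [FiniteDimensional K L] (hx : adjoin K (Set.range x) = ⊤)
    {z : L ⊗[K] L} (hz : z ∈ KaehlerDifferential.ideal K L) : z ∈ taylorFiltration x K 1 := by
  have hle : taylorFiltration x K 1 ≤ (KaehlerDifferential.ideal K L).restrictScalars L := by
    rw [taylorFiltration, Submodule.span_le]
    rintro _ ⟨β, hβ, rfl⟩
    exact Ideal.pow_le_self (Nat.one_le_iff_ne_zero.1 hβ) (taylorMonomial_mem_ideal_pow x β)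
  have hz0 : z ∈ taylorFiltration x K 0 := by simp [taylorFiltration_zero_eq_top x hx]
  have : taylorFiltration x K 0 ≤ Submodule.span L {1} ⊔ taylorFiltration x K 1 := by
    refine Submodule.span_le.2 ?_
    rintro _ ⟨β, -, rfl⟩
    by_cases hβ : 1 ≤ ∑ k, β k
    · exact Submodule.mem_sup_right (Submodule.subset_span ⟨β, hβ, rfl⟩)
    · have : β = 0 := by
        ext k
        simp at hβ
        exact hβ k
      rw [this, taylorMonomial_zero]
      exact Submodule.mem_sup_left (Submodule.mem_span_singleton_self _)
  obtain ⟨c, hc, w, hw, rfl⟩ := Submodule.mem_sup.1 (this hz0)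
  obtain ⟨c, rfl⟩ := Submodule.mem_span_singleton.1 hc
  have h1 : c • (1 : L ⊗[K] L) ∈ KaehlerDifferential.ideal K L := by
    simpa using sub_mem hz (hle hw)
  have : c = 0 := by
    simpa [KaehlerDifferential.ideal, RingHom.mem_ker, Algebra.TensorProduct.one_def,
      TensorProduct.smul_tmul'] using h1
  simpa [this] using hw

theorem ideal_pow_le_taylorFiltration [FiniteDimensional K L] (hx : adjoin K (Set.range x) = ⊤)
    (m : ℕ) {z : L ⊗[K] L} (hz : z ∈ KaehlerDifferential.ideal K L ^ m) :
    z ∈ taylorFiltration x K m := by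
  induction m generalizing z with
  | zero => simp [taylorFiltration_zero_eq_top x hx]
  | succ m ih =>
    rw [pow_succ] at hz
    refine Submodule.mul_induction_on hz (fun a ha b hb => ?_) fun a b => add_mem
    exact mul_mem_taylorFiltration x (ih ha) (ideal_le_taylorFiltration x hx hb)

variable [FiniteDimensional K L] [IsPurelyInseparable K L]

/-- The degree of `x k` is a power `q` of `p` with `x k ^ q` in `K`, so the `q`-th power of `1 ⊗ x k
- x k ⊗ 1` vanishes. -/
theorem taylorMonomial_eq_zero (p : ℕ) [Fact p.Prime] [CharP K p] {β : Fin n → ℕ} {k : Fin n}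
    (h : finrank K K⟮x k⟯ ≤ β k) : taylorMonomial x K β = 0 := by
  have : CharP (L ⊗[K] L) p := charP_of_injective_algebraMap (algebraMap K _).injective p
  refine Finset.prod_eq_zero (Finset.mem_univ k) (pow_eq_zero_of_le h ?_)
  have hf : finrank K K⟮x k⟯ = p ^ IsPurelyInseparable.elemExponent K (x k) := by
    rw [adjoin.finrank (Algebra.IsIntegral.isIntegral _),
      IsPurelyInseparable.minpoly_natDegree_eq' K p]
  have := IsPurelyInseparable.algebraMap_elemReduct_eq' K p (x k)
  rw [hf, sub_pow_char_pow, Algebra.TensorProduct.tmul_pow, Algebra.TensorProduct.tmul_pow,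
    ← this]
  simp [Algebra.algebraMap_eq_smul_one, TensorProduct.tmul_smul, TensorProduct.smul_tmul']

/-- The monomials of small multidegree in the elements `1 ⊗ xₖ - xₖ ⊗ 1` form an `L`-basis of
`L ⊗[K] L` if `L` is the tensor product of the fields `K(xₖ)`. -/
theorem exists_basis_taylorMonomial (p : ℕ) [Fact p.Prime] [CharP K p]
    (hx : adjoin K (Set.range x) = ⊤) (hd : ∏ k, finrank K K⟮x k⟯ = finrank K L) :
    ∃ b : Basis (Π k, Fin (finrank K K⟮x k⟯)) L (L ⊗[K] L),
      ∀ β, b β = taylorMonomial x K (fun k => (β k : ℕ)) := by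
  refine ⟨basisOfTopLeSpanOfCardEqFinrank (fun β => taylorMonomial x K (fun k => (β k : ℕ)))
    ?_ ?_, fun β => by rw [coe_basisOfTopLeSpanOfCardEqFinrank]⟩
  · rw [← taylorFiltration_zero_eq_top x hx, taylorFiltration, Submodule.span_le]
    rintro _ ⟨β, -, rfl⟩
    by_cases h : ∀ k, β k < finrank K K⟮x k⟯
    · exact Submodule.subset_span ⟨fun k => ⟨β k, h k⟩, rfl⟩
    · push Not at h
      obtain ⟨k, hk⟩ := h
      rw [taylorMonomial_eq_zero x p hk]
      exact zero_mem _
  · rw [finrank_baseChange, ← hd]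
    simp

end Taylor

/-! ### Taylor coefficients as differential operators -/

section TaylorOperators

variable {K L : Type*} [Field K] [Field L] [Algebra K L]

/-- The coordinate of `1 ⊗ a` with respect to a basis element of `L ⊗[K] L`, as a function
of `a`. -/
noncomputable def taylorCoeff {ι : Type*} (b : Basis ι L (L ⊗[K] L)) (β : ι) : L →ₗ[K] L :=
  (b.coord β).restrictScalars K ∘ₗ Algebra.TensorProduct.includeRight.toLinearMap

theorem taylorCoeff_apply {ι : Type*} (b : Basis ι L (L ⊗[K] L)) (β : ι) (a : L) :
    taylorCoeff b β a = b.repr (1 ⊗ₜ[K] a) β := rfl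

theorem sum_taylorCoeff_smul {ι : Type*} [Fintype ι] (b : Basis ι L (L ⊗[K] L)) (a : L) :
    ∑ β, taylorCoeff b β a • b β = 1 ⊗ₜ[K] a := by
  simp only [taylorCoeff_apply, b.sum_repr]

variable {n : ℕ} {x : Fin n → L} {b : Basis (Π k, Fin (finrank K K⟮x k⟯)) L (L ⊗[K] L)}

theorem repr_taylorMonomial [FiniteDimensional K L] [IsPurelyInseparable K L] (p : ℕ)
    [Fact p.Prime] [CharP K p]
    (hb : ∀ β, b β = taylorMonomial x K (fun k => (β k : ℕ)))
    (β : Π k, Fin (finrank K K⟮x k⟯)) (α : Fin n → ℕ) :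
    b.repr (taylorMonomial x K α) β = if α = fun k => (β k : ℕ) then 1 else 0 := by
  split_ifs with h
  · rw [h, ← hb, b.repr_self, Finsupp.single_eq_same]
  · by_cases hα : ∀ k, α k < finrank K K⟮x k⟯
    · have : taylorMonomial x K α = b (fun k => ⟨α k, hα k⟩) := by rw [hb]
      rw [this, b.repr_self, Finsupp.single_eq_of_ne]
      rintro rfl
      exact h rfl
    · push Not at hα
      obtain ⟨k, hk⟩ := hα
      simp [taylorMonomial_eq_zero x p hk]

theorem repr_eq_zero_of_mem_taylorFiltration [FiniteDimensional K L] [IsPurelyInseparable K L] (p : ℕ)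
    [Fact p.Prime] [CharP K p]
    (hb : ∀ β, b β = taylorMonomial x K (fun k => (β k : ℕ))) {m : ℕ}
    {β : Π k, Fin (finrank K K⟮x k⟯)} (hβ : ∑ k, (β k : ℕ) < m) {z : L ⊗[K] L}
    (hz : z ∈ taylorFiltration x K m) : b.repr z β = 0 := by
  suffices h : taylorFiltration x K m ≤ LinearMap.ker (b.coord β) from h hz
  rw [taylorFiltration, Submodule.span_le]
  rintro _ ⟨α, hα, rfl⟩
  change b.repr _ β = 0
  rw [repr_taylorMonomial p hb, if_neg]
  rintro rfl
  exact absurd hα hβ.not_ge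

theorem taylorCoeff_mem_diffOp [FiniteDimensional K L] [IsPurelyInseparable K L] (p : ℕ)
    [Fact p.Prime] [CharP K p]
    (hx : adjoin K (Set.range x) = ⊤)
    (hb : ∀ β, b β = taylorMonomial x K (fun k => (β k : ℕ))) {m : ℕ}
    {β : Π k, Fin (finrank K K⟮x k⟯)} (hβ : ∑ k, (β k : ℕ) ≤ m) :
    taylorCoeff b β ∈ diffOp K L m := by
  let I := KaehlerDifferential.ideal K L ^ (m + 1)
  refine ⟨((I.restrictScalars L).liftQ (b.coord β) fun z hz => ?_ :
    ((L ⊗[K] L) ⧸ I.restrictScalars L) →ₗ[L] L), fun a => rfl⟩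
  exact repr_eq_zero_of_mem_taylorFiltration p hb (Nat.lt_succ_of_le hβ)
    (ideal_pow_le_taylorFiltration x hx _ hz)

/-- Raising the expansion of `1 ⊗ a` to the power `p ^ j` acts termwise, so each coordinate of `1 ⊗
a ^ p ^ j` is a sum of `p ^ j`-th powers of coordinates of `1 ⊗ a`. -/
theorem taylorCoeff_mem_frobPow [FiniteDimensional K L] [IsPurelyInseparable K L] (p : ℕ)
    [Fact p.Prime] [CharP K p] [ExpChar L p]
    (hb : ∀ β, b β = taylorMonomial x K (fun k => (β k : ℕ)))
    (β : Π k, Fin (finrank K K⟮x k⟯)) (j : ℕ) {y : L} (hy : y ∈ frobPow L p j) :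
    taylorCoeff b β y ∈ frobPow L p j := by
  have : ExpChar (L ⊗[K] L) p := expChar_of_injective_algebraMap (algebraMap L _).injective p
  obtain ⟨a, rfl⟩ := mem_frobPow.1 hy
  rw [taylorCoeff_apply]
  have h : (1 : L) ⊗ₜ[K] (a ^ p ^ j) = (1 ⊗ₜ[K] a) ^ p ^ j := by
    rw [Algebra.TensorProduct.tmul_pow, one_pow]
  rw [h, ← sum_taylorCoeff_smul b, sum_pow_char_pow]
  simp only [hb, smul_pow, taylorMonomial_pow, map_sum, map_smul, Finsupp.coe_finsetSum,
    Finset.sum_apply, Finsupp.smul_apply, smul_eq_mul, repr_taylorMonomial p hb]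
  refine sum_mem fun γ _ => mul_mem (mem_frobPow.2 ⟨_, rfl⟩) ?_
  split_ifs
  exacts [one_mem _, zero_mem _]

/-- Apply `u` to the expansion of `1 ⊗ a`: monomials of degree above `m` lie in `I ^ (m + 1)` and
die in the quotient. -/
theorem diffOp_eq_sum_taylorCoeff (hb : ∀ β, b β = taylorMonomial x K (fun k => (β k : ℕ)))
    {m : ℕ} {D : L →ₗ[K] L} (hD : D ∈ diffOp K L m) :
    ∃ c : (Π k, Fin (finrank K K⟮x k⟯)) → L,
      D = ∑ β with ∑ k, (β k : ℕ) ≤ m, c β • taylorCoeff b β := by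
  obtain ⟨u, hu⟩ := hD
  refine ⟨fun β => u (Ideal.Quotient.mk _ (b β)), LinearMap.ext fun a => ?_⟩
  have hmk (c : L) (z : L ⊗[K] L) :
      Ideal.Quotient.mk (KaehlerDifferential.ideal K L ^ (m + 1)) (c • z) =
        c • Ideal.Quotient.mk (KaehlerDifferential.ideal K L ^ (m + 1)) z := rfl
  rw [← hu, ← sum_taylorCoeff_smul b]
  simp only [map_sum, hmk, map_smul, LinearMap.sum_apply, LinearMap.smul_apply, smul_eq_mul]
  rw [Finset.sum_filter]
  refine Finset.sum_congr rfl fun β _ => ?_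
  split_ifs with h
  · exact mul_comm _ _
  · have : b β ∈ KaehlerDifferential.ideal K L ^ (m + 1) := by
      rw [hb]
      exact Ideal.pow_le_pow_right (by omega) (taylorMonomial_mem_ideal_pow x _)
    rw [Ideal.Quotient.eq_zero_iff_mem.2 this, map_zero, mul_zero]

end TaylorOperators

theorem IsModularExtension.span_frobDiffOp (p : ℕ) [Fact p.Prime] (K L : Type*) [Field K] [Field L]
    [Algebra K L] [CharP K p] [ExpChar L p] [FiniteDimensional K L] [IsPurelyInseparable K L]
    (h : IsModularExtension K L) (i : ℕ) :
    Submodule.span L (frobDiffOp K L p i : Set (diffOp K L (p ^ i))) = ⊤ := by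
  obtain ⟨n, x, hx, hd⟩ := (isModularExtension_iff K L).1 h
  obtain ⟨b, hb⟩ := exists_basis_taylorMonomial x p hx hd
  rw [eq_top_iff]
  rintro ⟨D, hD⟩ -
  obtain ⟨c, hc⟩ := diffOp_eq_sum_taylorCoeff hb hD
  let E (β : Π k, Fin (finrank K K⟮x k⟯)) (hβ : ∑ k, (β k : ℕ) ≤ p ^ i) : diffOp K L (p ^ i) :=
    ⟨taylorCoeff b β, taylorCoeff_mem_diffOp p hx hb hβ⟩
  have hE : (⟨D, hD⟩ : diffOp K L (p ^ i)) =
      ∑ β : {β : Π k, Fin (finrank K K⟮x k⟯) // ∑ k, (β k : ℕ) ≤ p ^ i}, c β • E β β.2 := by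
    refine Subtype.ext ?_
    rw [AddSubmonoidClass.coe_finsetSum]
    simp only [hc, Submodule.coe_smul, E]
    exact (Finset.sum_subtype _ (by simp) fun β => c β • taylorCoeff b β)
  rw [hE]
  exact sum_mem fun β _ => Submodule.smul_mem _ _ (Submodule.subset_span
    fun j _ y hy => taylorCoeff_mem_frobPow p hb β j hy)

/-! ### Extending homomorphisms along `p`-th roots -/

section Extension

variable {K L S : Type*} [Field K] [Field L] [Algebra K L] [CommRing S] [Algebra K S]

theorem wellFoundedGT_intermediateField [FiniteDimensional K L] :
    WellFoundedGT (IntermediateField K L) :=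
  StrictMono.wellFoundedGT (β := Submodule K L)
    (f := fun N => Subalgebra.toSubmodule N.toSubalgebra) fun _ _ h => h

theorem minpoly_eq_X_pow_sub_C_of_pow_mem {p : ℕ} [Fact p.Prime] [CharP L p]
    (N : IntermediateField K L) {z : L} (hz : z ∉ N) (hzp : z ^ p ∈ N) :
    minpoly N z = Polynomial.X ^ p - Polynomial.C ⟨z ^ p, hzp⟩ := by
  have hp : p.Prime := Fact.out
  refine (minpoly.eq_of_irreducible_of_monic
    (X_pow_sub_C_irreducible_of_prime hp fun b hb => hz ?_) (by simp)
    (Polynomial.monic_X_pow_sub_C _ hp.ne_zero)).symm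
  have : (b : L) ^ p = z ^ p := congrArg Subtype.val hb
  rw [← frobenius_inj L p this]
  exact b.2

theorem exists_algHom_adjoin_simple {p : ℕ} [Fact p.Prime] [CharP L p]
    (N : IntermediateField K L) (f : N →ₐ[K] S) {z : L} (hz : z ∉ N) (hzp : z ^ p ∈ N) {v : S}
    (hv : v ^ p = f ⟨z ^ p, hzp⟩) :
    ∃ (N' : IntermediateField K L) (hN : N ≤ N') (hz' : z ∈ N') (g : N' →ₐ[K] S),
      (∀ M, N ≤ M → z ∈ M → N' ≤ M) ∧ (∀ a, g (inclusion hN a) = f a) ∧ g ⟨z, hz'⟩ = v := by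
  have hp : p.Prime := Fact.out
  let _ : Algebra N S := f.toRingHom.toAlgebra
  have : IsScalarTower K N S := IsScalarTower.of_algebraMap_eq fun c => (f.commutes c).symm
  have hmin := minpoly_eq_X_pow_sub_C_of_pow_mem N hz hzp
  have hint : IsIntegral N z := ⟨_, Polynomial.monic_X_pow_sub_C ⟨z ^ p, hzp⟩ hp.ne_zero, by simp⟩
  let g : N⟮z⟯ →ₐ[N] S := (adjoin.powerBasis hint).lift v (by
    rw [adjoin.powerBasis_gen, minpoly_gen, hmin]
    simp only [map_sub, map_pow, Polynomial.aeval_X, Polynomial.aeval_C, hv]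
    exact sub_self _)
  refine ⟨N⟮z⟯.restrictScalars K, fun a ha => N⟮z⟯.algebraMap_mem ⟨a, ha⟩,
    mem_adjoin_simple_self N z, g.restrictScalars K, fun M hM hzM => ?_, fun a => ?_, ?_⟩
  · have h : N⟮z⟯ ≤ extendScalars hM := adjoin_le_iff.2 (Set.singleton_subset_iff.2 hzM)
    exact fun w hw => h hw
  · exact g.commutes a
  · change g (AdjoinSimple.gen N z) = v
    rw [← adjoin.powerBasis_gen hint]
    exact (adjoin.powerBasis hint).lift_gen _ _

/-- Extend to a maximal intermediate field. A new `z` has minimal polynomial `X ^ p - z ^ p`, so any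
`p`-th root of the image of `z ^ p` may serve as its image, even in a non-reduced `S`. -/
theorem exists_algHom_of_pow_mem [FiniteDimensional K L] {p : ℕ} [Fact p.Prime] [CharP L p]
    {M M' : IntermediateField K L} (hM : M ≤ M') (f : M →ₐ[K] S)
    (hf : ∀ z ∈ M', ∃ (hz : z ^ p ∈ M) (s : S), s ^ p = f ⟨z ^ p, hz⟩) :
    ∃ g : M' →ₐ[K] S, ∀ a, g (inclusion hM a) = f a := by
  have := wellFoundedGT_intermediateField (K := K) (L := L)
  obtain ⟨N, ⟨⟨hMN, hNM', g, hg⟩, hmax⟩⟩ := exists_maximal_of_wellFoundedGT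
    (fun N : IntermediateField K L => ∃ (hMN : M ≤ N) (_ : N ≤ M') (g : N →ₐ[K] S),
      ∀ a, g (inclusion hMN a) = f a) ⟨M, le_rfl, hM, f, fun _ => rfl⟩
  suffices h : M' ≤ N by
    obtain rfl := le_antisymm h hNM'
    exact ⟨g, hg⟩
  intro z hz
  by_contra hzN
  obtain ⟨hzp, s, hs⟩ := hf z hz
  obtain ⟨N', hN, hzN', g', hmin, hg', -⟩ := exists_algHom_adjoin_simple N g hzN (hMN hzp)
    (hs.trans (hg ⟨z ^ p, hzp⟩).symm)
  exact hzN (hmax ⟨hMN.trans hN, hmin _ hNM' hz, g', fun a => (hg' _).trans (hg a)⟩ hN hzN')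

end Extension

/-! ### Truncated polynomial rings -/

section TruncatedPolynomial

open Polynomial

/-- The ring `R[X] / (X ^ r)`. -/
abbrev TruncatedPolynomial (R : Type*) [CommRing R] (r : ℕ) : Type _ :=
  R[X] ⧸ Ideal.span {(X : R[X]) ^ r}

namespace TruncatedPolynomial

/-- The coefficient of `X ^ i` of an element of `R[X] / (X ^ r)`, for `i < r`. -/
noncomputable def coeff (R : Type*) [CommRing R] {r i : ℕ} (h : i < r) :
    TruncatedPolynomial R r →ₗ[R] R :=
  (((Ideal.span {(X : R[X]) ^ r}).restrictScalars R).liftQ (lcoeff R i) fun P hP => by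
    obtain ⟨Q, rfl⟩ := Ideal.mem_span_singleton.1 hP
    simp [coeff_X_pow_mul', h] :
    (R[X] ⧸ (Ideal.span {(X : R[X]) ^ r}).restrictScalars R) →ₗ[R] R)

theorem coeff_mk (R : Type*) [CommRing R] {r i : ℕ} (h : i < r) (P : R[X]) :
    coeff R h (Ideal.Quotient.mk _ P) = P.coeff i := rfl

/-- The homomorphism `R[X] / (X ^ r) → R[X] / (X ^ (r * p))` with `X ↦ X ^ p`. -/
noncomputable def expand (R : Type*) [CommRing R] (p r : ℕ) :
    TruncatedPolynomial R r →ₐ[R] TruncatedPolynomial R (r * p) :=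
  Ideal.Quotient.liftₐ _ ((Ideal.Quotient.mkₐ R _).comp (Polynomial.expand R p)) fun P hP => by
    obtain ⟨Q, rfl⟩ := Ideal.mem_span_singleton.1 hP
    refine Ideal.Quotient.eq_zero_iff_mem.2 (Ideal.mem_span_singleton.2 ?_)
    simp [← pow_mul, mul_comm]

theorem expand_mk (R : Type*) [CommRing R] (p r : ℕ) (P : R[X]) :
    expand R p r (Ideal.Quotient.mk _ P) = Ideal.Quotient.mk _ (Polynomial.expand R p P) := rfl

/-- Over a perfect ring the coefficients are `p`-th powers, so `P(X ^ p)` is a `p`-th power. This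
supplies the roots for extending homomorphisms. -/
theorem exists_pow_eq_expand (R : Type*) [CommRing R] (p r : ℕ) [ExpChar R p] [PerfectRing R p]
    (s : TruncatedPolynomial R r) : ∃ v, v ^ p = expand R p r s := by
  obtain ⟨P, rfl⟩ := Ideal.Quotient.mk_surjective s
  obtain ⟨Q, rfl⟩ := Polynomial.map_surjective (frobenius R p) (surjective_frobenius R p) P
  refine ⟨Ideal.Quotient.mk _ Q, ?_⟩
  rw [← map_pow, ← map_frobenius_expand p, map_expand, expand_mk]

end TruncatedPolynomial

end TruncatedPolynomial

/-! ### Differential operators from deformations -/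

section Operators

variable {K L Ω : Type*} [Field K] [Field L] [Algebra K L] [Field Ω] [Algebra K Ω] [Algebra L Ω]
  [IsScalarTower K L Ω]

/-- Modulo `X`, `φ` is the inclusion `L → Ω`, so `I ^ (m + 1)` lands in `(X ^ (m + 1))`, which the
coefficient of `X ^ q` does not see. -/
theorem comp_coeff_mem_diffOp [IsPurelyInseparable K L] {r q m : ℕ} (hq : q < r) (hm : q ≤ m)
    (φ : L →ₐ[K] TruncatedPolynomial Ω r) (l : Ω →ₗ[L] L) :
    l.restrictScalars K ∘ₗ (TruncatedPolynomial.coeff Ω hq).restrictScalars K ∘ₗ φ.toLinearMap ∈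
      diffOp K L m := by
  obtain ⟨ψ, hψt⟩ : ∃ ψ : L ⊗[K] L →ₐ[L] TruncatedPolynomial Ω r,
      ∀ a b, ψ (a ⊗ₜ[K] b) = algebraMap L _ a * φ b :=
    ⟨Algebra.TensorProduct.lift (Algebra.ofId L _) φ fun _ _ => mul_comm _ _,
      fun a b => Algebra.TensorProduct.lift_tmul _ _ _ a b⟩
  let T : TruncatedPolynomial Ω r := Ideal.Quotient.mk _ Polynomial.X
  have hr : 0 < r := by omega
  let ε : TruncatedPolynomial Ω r →ₐ[Ω] Ω :=
    Ideal.Quotient.liftₐ _ (Polynomial.aeval 0) fun P hP => by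
      obtain ⟨Q, rfl⟩ := Ideal.mem_span_singleton.1 hP
      simp [hr.ne']
  -- By pure inseparability, `L` has at most one `K`-embedding into `Ω`.
  have hε (a : L) : ε (φ a) = algebraMap L Ω a :=
    congrArg (fun f : L →ₐ[K] Ω => f a)
      (Subsingleton.elim ((ε.restrictScalars K).comp φ) (IsScalarTower.toAlgHom K L Ω))
  have hψ : (KaehlerDifferential.ideal K L).map ψ ≤ Ideal.span {T} := by
    rw [← KaehlerDifferential.span_range_eq_ideal, Ideal.map_span, Ideal.span_le]
    rintro _ ⟨_, ⟨a, rfl⟩, rfl⟩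
    obtain ⟨P, hP⟩ := Ideal.Quotient.mk_surjective (φ a)
    have h0 : P.eval 0 = algebraMap L Ω a := by
      rw [← hε, ← hP]
      exact (Polynomial.coe_aeval_eq_eval (0 : Ω) ▸ rfl)
    have h1 : (Polynomial.X : Polynomial Ω) ∣ P - Polynomial.C (algebraMap L Ω a) := by
      rw [Polynomial.X_dvd_iff]
      simp [Polynomial.coeff_zero_eq_eval_zero, h0]
    have h2 : ψ (1 ⊗ₜ[K] a - a ⊗ₜ[K] 1) =
        Ideal.Quotient.mk _ (P - Polynomial.C (algebraMap L Ω a)) := by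
      simp only [map_sub, hψt, map_one, one_mul, mul_one, ← hP]
      rfl
    change ψ _ ∈ _
    rw [h2]
    exact Ideal.mem_span_singleton.2 (map_dvd _ h1)
  let I := KaehlerDifferential.ideal K L ^ (m + 1)
  let c : L ⊗[K] L →ₗ[L] L :=
    l ∘ₗ (TruncatedPolynomial.coeff Ω hq).restrictScalars L ∘ₗ ψ.toLinearMap
  refine ⟨((I.restrictScalars L).liftQ c fun z hz => ?_ :
    ((L ⊗[K] L) ⧸ I.restrictScalars L) →ₗ[L] L), fun a => ?_⟩
  · have h := Ideal.mem_map_of_mem ψ (show z ∈ I from hz)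
    rw [Ideal.map_pow] at h
    have h := Ideal.pow_right_mono hψ (m + 1) h
    rw [Ideal.span_singleton_pow] at h
    obtain ⟨w, hw⟩ := Ideal.mem_span_singleton.1 h
    obtain ⟨P, rfl⟩ := Ideal.Quotient.mk_surjective w
    change l (TruncatedPolynomial.coeff Ω hq (ψ z)) = 0
    rw [hw, ← map_pow, ← map_mul, TruncatedPolynomial.coeff_mk, Polynomial.coeff_X_pow_mul',
      if_neg (by omega), map_zero]
  · change l (TruncatedPolynomial.coeff Ω hq (ψ (1 ⊗ₜ[K] a))) =
      l (TruncatedPolynomial.coeff Ω hq (φ a))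
    simp [hψt]

end Operators

/-! ### The fields `K(L ^ q)` -/

section PowField

variable {K L : Type*} [Field K] [Field L] [Algebra K L]

/-- The field `K(L ^ q)` generated over `K` by the `q`-th powers of the elements of `L`. -/
def powField (K L : Type*) [Field K] [Field L] [Algebra K L] (q : ℕ) : IntermediateField K L :=
  adjoin K (Set.range fun x : L => x ^ q)

theorem pow_mem_powField (q : ℕ) (x : L) : x ^ q ∈ powField K L q :=
  subset_adjoin K _ ⟨x, rfl⟩

theorem pow_mem_of_mem_adjoin (p : ℕ) [ExpChar L p] (k : ℕ) {S : Set L} {R : IntermediateField K L}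
    (h : ∀ s ∈ S, s ^ p ^ k ∈ R) {z : L} (hz : z ∈ adjoin K S) : z ^ p ^ k ∈ R := by
  induction hz using adjoin_induction with
  | mem s hs => exact h s hs
  | algebraMap c => exact pow_mem (R.algebraMap_mem c) _
  | add a b _ _ ha hb => rw [add_pow_expChar_pow]; exact add_mem ha hb
  | inv a _ ha => rw [inv_pow]; exact inv_mem ha
  | mul a b _ _ ha hb => rw [mul_pow]; exact mul_mem ha hb

theorem pow_mem_powField_mul (p : ℕ) [ExpChar L p] (q k : ℕ) {z : L} (hz : z ∈ powField K L q) :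
    z ^ p ^ k ∈ powField K L (q * p ^ k) := by
  refine pow_mem_of_mem_adjoin p k ?_ hz
  rintro _ ⟨x, rfl⟩
  simpa only [← pow_mul] using pow_mem_powField (K := K) (q * p ^ k) x

theorem powField_one : powField K L 1 = ⊤ := by
  rw [powField]
  simp

theorem powField_le_powField {q r : ℕ} (h : q ∣ r) : powField K L r ≤ powField K L q := by
  obtain ⟨c, rfl⟩ := h
  refine adjoin_le_iff.2 ?_
  rintro _ ⟨x, rfl⟩
  have h := pow_mem_powField (K := K) q (x ^ c)
  rwa [← pow_mul, mul_comm] at h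

theorem powField_eq_bot {q : ℕ} (h : ∀ x : L, x ^ q ∈ (algebraMap K L).range) :
    powField K L q = ⊥ := by
  rw [eq_bot_iff, powField, adjoin_le_iff]
  rintro _ ⟨x, rfl⟩
  exact mem_bot.2 (h x)

end PowField

/-! ### Constants of differential operators -/

section Constants

variable {K L Ω : Type*} [Field K] [Field L] [Algebra K L] [Field Ω] [Algebra K Ω] [Algebra L Ω]

/-- Along a tower of fields in which each is generated by `p`-th roots over the preceding one,
a first order deformation of the bottom field extends after a Frobenius twist. -/
theorem exists_algHom_truncatedPolynomial_of_tower [FiniteDimensional K L] {p : ℕ} [Fact p.Prime]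
    [CharP L p] [ExpChar Ω p] [PerfectRing Ω p] {E : ℕ → IntermediateField K L}
    (hE : ∀ k, E k ≤ E (k + 1)) (hEp : ∀ k, ∀ z ∈ E (k + 1), z ^ p ∈ E k) {y : L} (hy : y ∈ E 0)
    (f : E 0 →ₐ[K] TruncatedPolynomial Ω p)
    (hf : f ⟨y, hy⟩ = Ideal.Quotient.mk _ (Polynomial.C (algebraMap L Ω y) + Polynomial.X))
    (k : ℕ) :
    ∃ (hyk : y ∈ E k) (g : E k →ₐ[K] TruncatedPolynomial Ω (p ^ (k + 1))), g ⟨y, hyk⟩ =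
      Ideal.Quotient.mk _ (Polynomial.C (algebraMap L Ω y) + Polynomial.X ^ p ^ k) := by
  induction k with
  | zero =>
    rw [zero_add, pow_one, pow_zero, pow_one]
    exact ⟨hy, f, hf⟩
  | succ k ih =>
    obtain ⟨hyk, g, hg⟩ := ih
    obtain ⟨g', hg'⟩ := exists_algHom_of_pow_mem (p := p) (hE k)
      (((TruncatedPolynomial.expand Ω p (p ^ (k + 1))).restrictScalars K).comp g)
      fun z hz => ⟨hEp k z hz, TruncatedPolynomial.exists_pow_eq_expand Ω p _ _⟩
    rw [pow_succ p (k + 1)]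
    refine ⟨hE k hyk, g', (hg' ⟨y, hyk⟩).trans ?_⟩
    change TruncatedPolynomial.expand Ω p _ (g _) = _
    rw [hg, TruncatedPolynomial.expand_mk]
    simp [← pow_mul, pow_succ']

/-- Start with constants on `K(L ^ p ^ (m + 1))` and `y ↦ y + X` modulo `X ^ p`, allowed since `(y +
X) ^ p = y ^ p` there. Constant roots extend this to `K(L ^ p ^ m)`, and each of the `m` remaining
levels replaces `X` by `X ^ p`. -/
theorem exists_algHom_truncatedPolynomial [IsScalarTower K L Ω] [FiniteDimensional K L] {p : ℕ}
    [Fact p.Prime] [CharP L p] [ExpChar Ω p] [PerfectRing Ω p] {m : ℕ} {y : L} (hy : y ∈ powField K L (p ^ m))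
    (hy' : y ∉ powField K L (p ^ (m + 1))) :
    ∃ φ : L →ₐ[K] TruncatedPolynomial Ω (p ^ (m + 1)), φ y =
      Ideal.Quotient.mk _ (Polynomial.C (algebraMap L Ω y) + Polynomial.X ^ p ^ m) := by
  have hpow {z : L} (hz : z ∈ powField K L (p ^ m)) : z ^ p ∈ powField K L (p ^ (m + 1)) := by
    simpa [pow_succ] using pow_mem_powField_mul p (p ^ m) 1 hz
  let c : Ω →ₐ[K] TruncatedPolynomial Ω p := (Algebra.ofId Ω _).restrictScalars K
  have hc (a : Ω) : c a = Ideal.Quotient.mk _ (Polynomial.C a) := rfl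
  let f : powField K L (p ^ (m + 1)) →ₐ[K] TruncatedPolynomial Ω p :=
    (c.comp (IsScalarTower.toAlgHom K L Ω)).comp (powField K L (p ^ (m + 1))).val
  have hf (a : powField K L (p ^ (m + 1))) :
      f a = Ideal.Quotient.mk _ (Polynomial.C (algebraMap L Ω a)) := rfl
  obtain ⟨N, hN, hyN, g, hNmin, hg, hgy⟩ := exists_algHom_adjoin_simple
    (p := p) (powField K L (p ^ (m + 1))) f hy' (hpow hy)
    (v := Ideal.Quotient.mk _ (Polynomial.C (algebraMap L Ω y) + Polynomial.X)) (by
      rw [hf, ← map_pow, add_pow_expChar, Ideal.Quotient.eq]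
      simp)
  have hle : powField K L (p ^ (m + 1)) ≤ powField K L (p ^ m) :=
    powField_le_powField (pow_dvd_pow p m.le_succ)
  obtain ⟨g', hg'⟩ := exists_algHom_of_pow_mem (p := p) (hNmin _ hle hy) g fun z hz =>
    ⟨hN (hpow hz), by
      obtain ⟨a, ha⟩ : ∃ a, a ^ p = algebraMap L Ω (z ^ p) := surjective_frobenius Ω p _
      refine ⟨Ideal.Quotient.mk _ (Polynomial.C a), ?_⟩
      rw [← map_pow, ← map_pow, ha]
      exact (hg ⟨z ^ p, hpow hz⟩).symm⟩
  obtain ⟨hyE, φ, hφ⟩ := exists_algHom_truncatedPolynomial_of_tower (p := p)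
    (E := fun k => powField K L (p ^ (m - k)))
    (fun k => powField_le_powField (pow_dvd_pow p (by omega)))
    (fun k z hz => by
      by_cases hk : m ≤ k
      · simp [Nat.sub_eq_zero_of_le hk, powField_one]
      · have := pow_mem_powField_mul p _ 1 hz
        rwa [pow_one, ← pow_succ, show m - (k + 1) + 1 = m - k by omega] at this)
    hy g' ((hg' ⟨y, hyN⟩).trans hgy) m
  have htop : (⊤ : IntermediateField K L) ≤ powField K L (p ^ (m - m)) := by
    simp [powField_one]
  exact ⟨φ.comp ((inclusion htop).comp topEquiv.symm.toAlgHom), hφ⟩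

/-- The constants of the differential operators of order at most `p ^ (e - 1)` of a purely
inseparable extension of exponent at most `e` are the elements of the base field. -/
theorem exists_diffOp_apply_ne [FiniteDimensional K L] [IsPurelyInseparable K L] {p : ℕ}
    [Fact p.Prime] [CharP L p] {e : ℕ} (he : ∀ a : L, a ^ p ^ e ∈ (algebraMap K L).range) {y : L}
    (hy : y ∉ (algebraMap K L).range) : ∃ D ∈ diffOp K L (p ^ (e - 1)), D y ≠ D 1 * y := by
  have hp : p.Prime := Fact.out
  have hbot : y ∉ powField K L (p ^ e) := by
    rw [powField_eq_bot he]
    exact hy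
  obtain ⟨m, hme, hm, hm'⟩ : ∃ m < e, y ∈ powField K L (p ^ m) ∧ y ∉ powField K L (p ^ (m + 1)) := by
    by_contra! h
    have (k : ℕ) (hk : k ≤ e) : y ∈ powField K L (p ^ k) := by
      induction k with
      | zero => simp [powField_one]
      | succ k ih => exact h k hk (ih (by omega))
    exact hbot (this e le_rfl)
  -- The algebraic closure serves as a perfect `Ω`; the retraction `l` returns coefficients to `L`.
  have : CharP (AlgebraicClosure L) p := inferInstance
  have : ExpChar (AlgebraicClosure L) p := inferInstance
  have : PerfectRing (AlgebraicClosure L) p := PerfectField.toPerfectRing p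
  obtain ⟨φ, hφ⟩ := exists_algHom_truncatedPolynomial (Ω := AlgebraicClosure L) hm hm'
  obtain ⟨l, hl⟩ := (Algebra.linearMap L (AlgebraicClosure L)).exists_leftInverse_of_injective
    (LinearMap.ker_eq_bot.2 (algebraMap L (AlgebraicClosure L)).injective)
  have hl1 : l 1 = 1 := by simpa using LinearMap.congr_fun hl 1
  have hq : p ^ m < p ^ (m + 1) := Nat.pow_lt_pow_right hp.one_lt m.lt_succ_self
  have hq0 : p ^ m ≠ 0 := pow_ne_zero _ hp.ne_zero
  refine ⟨_, comp_coeff_mem_diffOp hq (Nat.pow_le_pow_right hp.pos (by omega)) φ l, ?_⟩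
  have h1 : TruncatedPolynomial.coeff (AlgebraicClosure L) hq (φ 1) = 0 := by
    rw [map_one, ← map_one (Ideal.Quotient.mk _), TruncatedPolynomial.coeff_mk,
      Polynomial.coeff_one, if_neg hq0]
  have hy1 : TruncatedPolynomial.coeff (AlgebraicClosure L) hq (φ y) = 1 := by
    rw [hφ, TruncatedPolynomial.coeff_mk]
    rw [Polynomial.coeff_add, Polynomial.coeff_C, if_neg hq0, Polynomial.coeff_X_pow_self, zero_add]
  change l (TruncatedPolynomial.coeff _ hq (φ y)) ≠ l (TruncatedPolynomial.coeff _ hq (φ 1)) * y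
  rw [h1, hy1, hl1]
  simp

end Constants

/-! ### Linear disjointness from operators -/

section LinearDisjointness

variable {K L : Type*} [Field K] [Field L] [Algebra K L] {M : Subfield L} {𝒟 : Set (L →ₗ[K] L)}

/-- If `K`-linear operators preserve a subfield `M` and have no constants in `M` outside `K`, then
families in `K` which are linearly independent over `M ∩ K` are linearly independent over `M`. -/
theorem eq_zero_of_sum_mul_algebraMap_eq_zero (hM : ∀ D ∈ 𝒟, ∀ y ∈ M, D y ∈ M)
    (hc : ∀ y ∈ M, (∀ D ∈ 𝒟, D y = D 1 * y) → y ∈ (algebraMap K L).range) {ι : Type*} {v : ι → K}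
    (hv : LinearIndependent (M.comap (algebraMap K L)) v) (s : Finset ι) {c : ι → L}
    (hcM : ∀ i, c i ∈ M) (h : ∑ i ∈ s, c i * algebraMap K L (v i) = 0) {i : ι} (hi : i ∈ s) :
    c i = 0 := by
  classical
  induction s using Finset.strongInduction generalizing c i with
  | H s ih =>
  by_contra hi0
  -- With coefficient `1` at `i`, subtracting `D 1` times the relation from its image under `D`
  -- gives a shorter one. By induction all `a j` are constants, so the relation descends to `M ∩ K`.
  let a (j : ι) : L := c j / c i
  have haM (j : ι) : a j ∈ M := div_mem (hcM j) (hcM i)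
  have hai : a i = 1 := div_self hi0
  have ha : ∑ j ∈ s, a j * algebraMap K L (v j) = 0 := by
    have : ∑ j ∈ s, a j * algebraMap K L (v j) = (∑ j ∈ s, c j * algebraMap K L (v j)) / c i := by
      rw [Finset.sum_div]
      exact Finset.sum_congr rfl fun j _ => by simp only [a]; ring
    rw [this, h, zero_div]
  have hD {D : L →ₗ[K] L} (hD : D ∈ 𝒟) {j : ι} (hj : j ∈ s) : D (a j) = D 1 * a j := by
    by_cases hji : j = i
    · rw [hji, hai, mul_one]
    have h1 : ∑ j ∈ s, D (a j) * algebraMap K L (v j) = 0 := by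
      have := congrArg D ha
      rw [map_sum, map_zero] at this
      rw [← this]
      refine Finset.sum_congr rfl fun j _ => ?_
      rw [mul_comm (a j), ← Algebra.smul_def, map_smul, Algebra.smul_def, mul_comm]
    have h2 : ∑ j ∈ s, (D (a j) - D 1 * a j) * algebraMap K L (v j) = 0 := by
      simp only [sub_mul, Finset.sum_sub_distrib, h1, mul_assoc, ← Finset.mul_sum, ha, mul_zero,
        sub_zero]
    rw [← Finset.sum_erase (a := i) _ (by simp [hai])] at h2
    exact sub_eq_zero.1 (ih _ (Finset.erase_ssubset hi)
      (fun j => sub_mem (hM D hD _ (haM j)) (mul_mem (hM D hD _ (one_mem M)) (haM j))) h2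
      (Finset.mem_erase.2 ⟨hji, hj⟩))
  have hK (j : ι) (hj : j ∈ s) : ∃ f : M.comap (algebraMap K L), algebraMap K L f = a j := by
    obtain ⟨f, hf⟩ := hc (a j) (haM j) fun D hD' => hD hD' hj
    exact ⟨⟨f, by simp [hf, haM j]⟩, hf⟩
  choose! f hf using hK
  have hsum : ∑ j ∈ s, f j • v j = 0 := by
    apply (algebraMap K L).injective
    rw [map_sum, map_zero, ← ha]
    refine Finset.sum_congr rfl fun j hj => ?_
    rw [← hf j hj, ← map_mul]
    rfl
  have := linearIndependent_iff'.1 hv s f hsum i hi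
  have h1 := hf i hi
  rw [this, hai] at h1
  simp at h1

/-- The linear disjointness of `M` and `K` over `M ∩ K`, for a subfield `M` which is preserved by
`K`-linear operators without constants in `M` outside `K`. -/
theorem mem_closure_of_mem_span (hM : ∀ D ∈ 𝒟, ∀ y ∈ M, D y ∈ M)
    (hc : ∀ y ∈ M, (∀ D ∈ 𝒟, D y = D 1 * y) → y ∈ (algebraMap K L).range) {S : Set L}
    (hS : S ⊆ M) {x : L} (hx : x ∈ M) (hxS : x ∈ Submodule.span K S) :
    x ∈ AddSubmonoid.closure
      {w | ∃ c : K, algebraMap K L c ∈ M ∧ ∃ s ∈ S, algebraMap K L c * s = w} := by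
  classical
  obtain ⟨n, f, g, rfl⟩ := Submodule.mem_span_set'.1 hxS
  set x := ∑ α, f α • (g α : L) with hxdef
  let F := M.comap (algebraMap K L)
  -- A basis of `K` over `M ∩ K` containing `1` lets `x` be isolated by comparing coefficients at
  -- `1`.
  have hli : LinearIndepOn F id ({1} : Set K) := LinearIndepOn.singleton (by simp)
  let b := Basis.extend hli
  let i₀ : hli.extend (Set.subset_univ _) := ⟨1, hli.subset_extend _ rfl⟩
  have hb : b i₀ = 1 := Basis.extend_apply_self hli i₀
  let T : Finset (hli.extend (Set.subset_univ _)) :=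
    insert i₀ (Finset.univ.biUnion fun α => (b.repr (f α)).support)
  have hfT (α : Fin n) : ∑ i ∈ T, (b.repr (f α) i : K) * b i = f α := by
    conv_rhs => rw [← b.linearCombination_repr (f α), Finsupp.linearCombination_apply]
    rw [Finsupp.sum_of_support_subset _ (s := T) ?_ _ (by simp)]
    · rfl
    · exact fun i hi => Finset.mem_insert_of_mem (Finset.mem_biUnion.2 ⟨α, Finset.mem_univ _, hi⟩)
  let c (i : hli.extend (Set.subset_univ _)) : L :=
    (if i = i₀ then x else 0) - ∑ α, algebraMap K L (b.repr (f α) i) * g α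
  have hcM (i) : c i ∈ M := by
    refine sub_mem ?_ (sum_mem fun α _ => mul_mem (b.repr (f α) i).2 (hS (g α).2))
    split_ifs
    exacts [hx, zero_mem M]
  have hsum : ∑ i ∈ T, c i * algebraMap K L (b i) = 0 := by
    simp only [c, sub_mul, Finset.sum_sub_distrib, Finset.sum_mul, ite_mul, zero_mul]
    rw [Finset.sum_ite_eq' T i₀, if_pos (Finset.mem_insert_self _ _), hb, map_one, mul_one,
      Finset.sum_comm, sub_eq_zero, hxdef]
    refine Finset.sum_congr rfl fun α _ => ?_
    rw [Algebra.smul_def]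
    conv_lhs => rw [← hfT α, map_sum, Finset.sum_mul]
    refine Finset.sum_congr rfl fun i _ => ?_
    rw [map_mul]
    ring
  have h0 := eq_zero_of_sum_mul_algebraMap_eq_zero hM hc b.linearIndependent T hcM hsum
    (Finset.mem_insert_self i₀ _)
  simp only [c, if_true, sub_eq_zero] at h0
  rw [h0]
  exact sum_mem fun α _ => AddSubmonoid.subset_closure
    ⟨_, (b.repr (f α) i₀).2, g α, (g α).2, rfl⟩

end LinearDisjointness

/-! ### Degrees of purely inseparable extensions -/

section Degrees

variable {K L : Type*} [Field K] [Field L] [Algebra K L]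

theorem finrank_adjoin_image_le {ι : Type*} [DecidableEq ι] (f : ι → L) (s : Finset ι) :
    finrank K (adjoin K (f '' s)) ≤ ∏ i ∈ s, finrank K K⟮f i⟯ := by
  induction s using Finset.induction_on with
  | empty => rw [Finset.coe_empty, Set.image_empty, adjoin_empty, IntermediateField.finrank_bot]; rfl
  | insert i s hi ih =>
    rw [Finset.prod_insert hi, Finset.coe_insert, Set.image_insert_eq, Set.insert_eq, adjoin_union]
    exact (finrank_sup_le _ _).trans (Nat.mul_le_mul_left _ ih)

variable [FiniteDimensional K L] {p : ℕ} [Fact p.Prime] [CharP L p]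

theorem finrank_sup_adjoin_simple {N : IntermediateField K L} {z : L} (hz : z ∉ N)
    (hzp : z ^ p ∈ N) : finrank K (N ⊔ K⟮z⟯ : IntermediateField K L) = finrank K N * p := by
  rw [← restrictScalars_adjoin_eq_sup]
  change finrank K N⟮z⟯ = _
  rw [← finrank_mul_finrank K N N⟮z⟯, adjoin.finrank (Algebra.IsIntegral.isIntegral _),
    minpoly_eq_X_pow_sub_C_of_pow_mem N hz hzp, Polynomial.natDegree_X_pow_sub_C]

/-- If `z` lay in `K(z ^ p)`, then `z` and `z ^ p` would have equal exponents; but `p`-th powers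
lower the exponent of an element outside `K`. -/
theorem finrank_adjoin_simple_eq_mul [IsPurelyInseparable K L] [CharP K p] {z : L}
    (hz : z ∉ (algebraMap K L).range) : finrank K K⟮z⟯ = finrank K K⟮z ^ p⟯ * p := by
  have hle : K⟮z ^ p⟯ ≤ K⟮z⟯ :=
    adjoin_simple_le_iff.2 (pow_mem (mem_adjoin_simple_self K z) p)
  rw [← finrank_sup_adjoin_simple (N := K⟮z ^ p⟯) (z := z) (fun h => ?_)
    (mem_adjoin_simple_self K _), sup_eq_right.2 hle]
  have heq : K⟮z ^ p⟯ = K⟮z⟯ := le_antisymm hle (adjoin_simple_le_iff.2 h)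
  have hf (w : L) : finrank K K⟮w⟯ = p ^ IsPurelyInseparable.elemExponent K w := by
    rw [adjoin.finrank (Algebra.IsIntegral.isIntegral _),
      IsPurelyInseparable.minpoly_natDegree_eq' K p]
  have hp : p.Prime := Fact.out
  have he : IsPurelyInseparable.elemExponent K (z ^ p) = IsPurelyInseparable.elemExponent K z :=
    Nat.pow_right_injective hp.two_le (by
      have := congrArg (fun N : IntermediateField K L => finrank K N) heq
      simpa only [hf] using this)
  have hmem := IsPurelyInseparable.elemExponent_def' K p z
  by_cases h0 : IsPurelyInseparable.elemExponent K z = 0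
  · rw [h0, pow_zero, pow_one] at hmem
    exact hz hmem
  · obtain ⟨k, hk⟩ := Nat.exists_eq_succ_of_ne_zero h0
    rw [hk, pow_succ', pow_mul] at hmem
    have := IsPurelyInseparable.elemExponent_le_of_pow_mem' p hmem
    omega

end Degrees

/-! ### Sweedler's criterion -/

section Sweedler

variable {K L : Type*} [Field K] [Field L] [Algebra K L]

/-- The `q`-th powers of the elements of `s` do not lie in `K`, and the field they generate over
`K` is the tensor product of the fields generated by each of them. -/
def IsModularFamily (K : Type*) [Field K] [Algebra K L] (q : ℕ) (s : Finset L) : Prop :=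
  (∀ x ∈ s, x ^ q ∉ (algebraMap K L).range) ∧
    ∏ x ∈ s, finrank K K⟮x ^ q⟯ = finrank K (adjoin K ((fun x => x ^ q) '' (s : Set L)))

theorem IsModularFamily.insert [FiniteDimensional K L] {p : ℕ} [Fact p.Prime] [CharP L p]
    [DecidableEq L] {j : ℕ} {s : Finset L}
    (hs : IsModularFamily K (p ^ j) s) {l : L} (hl : l ^ p ^ (j + 1) ∈ (algebraMap K L).range)
    (hls : l ^ p ^ j ∉ adjoin K ((fun x => x ^ p ^ j) '' (s : Set L))) :
    IsModularFamily K (p ^ j) (insert l s) := by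
  have hpp : (l ^ p ^ j) ^ p = l ^ p ^ (j + 1) := by rw [← pow_mul, pow_succ]
  have hrange : l ^ p ^ j ∉ (algebraMap K L).range := by
    rintro ⟨c, hc⟩
    exact hls (hc ▸ IntermediateField.algebraMap_mem _ c)
  have hmem {N : IntermediateField K L} : (l ^ p ^ j) ^ p ∈ N := by
    obtain ⟨c, hc⟩ := hl
    rw [hpp, ← hc]
    exact N.algebraMap_mem c
  have hbot : finrank K K⟮l ^ p ^ j⟯ = p := by
    have := finrank_sup_adjoin_simple (p := p) (N := (⊥ : IntermediateField K L))
      (fun h => hrange (mem_bot.1 h)) hmem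
    rwa [bot_sup_eq, IntermediateField.finrank_bot, one_mul] at this
  refine ⟨fun x hx => ?_, ?_⟩
  · obtain rfl | hx := Finset.mem_insert.1 hx
    exacts [hrange, hs.1 x hx]
  · rw [Finset.prod_insert fun h => hls (subset_adjoin K _ ⟨l, h, rfl⟩), Finset.coe_insert,
      Set.image_insert_eq, Set.insert_eq, adjoin_union, sup_comm,
      finrank_sup_adjoin_simple (p := p) hls hmem, hs.2, hbot, mul_comm]

/-- Inserting an `l` whose `l ^ p ^ j` is missing multiplies both degree counts by `p`, so a family
generating a maximal field misses none. -/
theorem IsModularFamily.exists_superset [FiniteDimensional K L] {p : ℕ} [Fact p.Prime]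
    [CharP L p] {j : ℕ} {s : Finset L}
    (hs : IsModularFamily K (p ^ j) s) :
    ∃ t, s ⊆ t ∧ IsModularFamily K (p ^ j) t ∧
      ∀ l : L, l ^ p ^ (j + 1) ∈ (algebraMap K L).range →
        l ^ p ^ j ∈ adjoin K ((fun x => x ^ p ^ j) '' (t : Set L)) := by
  classical
  have := wellFoundedGT_intermediateField (K := K) (L := L)
  obtain ⟨N, ⟨t, hst, ht, rfl⟩, hmax⟩ := exists_maximal_of_wellFoundedGT
    (fun N : IntermediateField K L => ∃ t, s ⊆ t ∧ IsModularFamily K (p ^ j) t ∧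
      adjoin K ((fun x => x ^ p ^ j) '' (t : Set L)) = N) ⟨_, s, subset_rfl, hs, rfl⟩
  refine ⟨t, hst, ht, fun l hl => ?_⟩
  by_contra hlt
  refine hlt (hmax ⟨_, hst.trans (Finset.subset_insert l t), ht.insert hl hlt, rfl⟩
    (adjoin.mono _ _ _ (Set.image_mono (by simp))) (subset_adjoin K _ ⟨l, by simp, rfl⟩))

variable [FiniteDimensional K L] [IsPurelyInseparable K L] {p : ℕ} [Fact p.Prime] [CharP K p]
  [CharP L p]

/-- In a modular family of `q * p`-th powers, the `q`-th powers are `p`-independent. -/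
theorem IsModularFamily.pow_notMem [DecidableEq L] {j : ℕ} {s t : Finset L} (hts : t ⊆ s)
    (hs : IsModularFamily K (p ^ (j + 1)) s) {x : L} (hx : x ∈ s) (hxt : x ∉ t) :
    x ^ p ^ j ∉ adjoin K ((fun x => x ^ p ^ (j + 1)) '' (s : Set L)) ⊔
      adjoin K ((fun x => x ^ p ^ j) '' (t : Set L)) := by
  intro h
  rw [← adjoin_union] at h
  -- Only the exponent at `x` is raised. The `p`-th power of the hypothesis shows that `f` still
  -- generates at least the old field, although its product of degrees is strictly smaller.
  let f (y : L) : L := if y = x then y ^ p ^ (j + 2) else y ^ p ^ (j + 1)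
  have hpp (y : L) (k : ℕ) : (y ^ p ^ k) ^ p = y ^ p ^ (k + 1) := by rw [← pow_mul, pow_succ]
  have hf {y : L} (hy : y ∈ s) : f y ∈ adjoin K (f '' (s : Set L)) :=
    subset_adjoin K _ ⟨y, hy, rfl⟩
  have hxR : x ^ p ^ (j + 1) ∈ adjoin K (f '' (s : Set L)) := by
    have := pow_mem_of_mem_adjoin p 1 (R := adjoin K (f '' (s : Set L))) ?_ h
    · rwa [pow_one, hpp] at this
    rintro _ (⟨y, hy, rfl⟩ | ⟨y, hy, rfl⟩)
    · rw [pow_one, hpp]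
      have hfy := hf hy
      by_cases hyx : y = x
      · simpa [f, hyx] using hfy
      · rw [← hpp]
        refine pow_mem ?_ p
        simpa [f, hyx] using hfy
    · rw [pow_one, hpp]
      have hfy := hf (hts hy)
      have hyx : y ≠ x := fun h => hxt (h ▸ hy)
      simpa [f, hyx] using hfy
  have hle : adjoin K ((fun x => x ^ p ^ (j + 1)) '' (s : Set L)) ≤ adjoin K (f '' (s : Set L)) := by
    refine adjoin_le_iff.2 ?_
    rintro _ ⟨y, hy, rfl⟩
    by_cases hyx : y = x
    · exact hyx ▸ hxR
    · simpa [f, hyx] using hf hy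
  have hlt : ∏ y ∈ s, finrank K K⟮f y⟯ < ∏ y ∈ s, finrank K K⟮y ^ p ^ (j + 1)⟯ := by
    have hx1 : finrank K K⟮f x⟯ < finrank K K⟮x ^ p ^ (j + 1)⟯ := by
      have hfx : f x = x ^ p ^ (j + 2) := if_pos rfl
      rw [finrank_adjoin_simple_eq_mul (p := p) (hs.1 x hx), hpp, hfx]
      exact lt_mul_of_one_lt_right finrank_pos (Fact.out : p.Prime).one_lt
    refine Finset.prod_lt_prod (fun y _ => finrank_pos) (fun y _ => ?_) ⟨x, hx, hx1⟩
    by_cases hyx : y = x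
    · exact hyx ▸ hx1.le
    · rw [show f y = y ^ p ^ (j + 1) from if_neg hyx]
  have h1 := (finrank_le_of_le_right hle).trans (finrank_adjoin_image_le f s)
  exact absurd (hs.2 ▸ hlt) h1.not_gt

/-- By `p`-independence, each adjoined `x ^ p ^ j` multiplies the total degree by `p`; each simple
factor also grows by `p`, so the counts still agree. -/
theorem IsModularFamily.root {j : ℕ} {s : Finset L} (hs : IsModularFamily K (p ^ (j + 1)) s) :
    IsModularFamily K (p ^ j) s := by
  classical
  have hpp (y : L) : (y ^ p ^ j) ^ p = y ^ p ^ (j + 1) := by rw [← pow_mul, pow_succ]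
  have hrange : ∀ x ∈ s, x ^ p ^ j ∉ (algebraMap K L).range := fun x hx h =>
    hs.1 x hx (hpp x ▸ pow_mem h p)
  refine ⟨hrange, ?_⟩
  have h (t : Finset L) (ht : t ⊆ s) :
      finrank K (adjoin K ((fun x => x ^ p ^ (j + 1)) '' (s : Set L)) ⊔
        adjoin K ((fun x => x ^ p ^ j) '' (t : Set L)) : IntermediateField K L) =
      finrank K (adjoin K ((fun x => x ^ p ^ (j + 1)) '' (s : Set L))) * p ^ t.card := by
    induction t using Finset.induction_on with
    | empty =>
      rw [Finset.coe_empty, Set.image_empty, adjoin_empty, sup_bot_eq, Finset.card_empty, pow_zero,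
        mul_one]
    | insert x t hxt ih =>
      have hxs := ht (Finset.mem_insert_self x t)
      have hts := (Finset.subset_insert x t).trans ht
      rw [Finset.coe_insert, Set.image_insert_eq, Set.insert_eq, adjoin_union, sup_comm K⟮_⟯,
        ← sup_assoc, finrank_sup_adjoin_simple (p := p) (hs.pow_notMem hts hxs hxt), ih hts,
        Finset.card_insert_of_notMem hxt, pow_succ p t.card, mul_assoc]
      rw [hpp]
      exact (le_sup_left : adjoin K ((fun x => x ^ p ^ (j + 1)) '' (s : Set L)) ≤ _)
        (subset_adjoin K _ ⟨x, hxs, rfl⟩)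
  have hle : adjoin K ((fun x => x ^ p ^ (j + 1)) '' (s : Set L)) ≤
      adjoin K ((fun x => x ^ p ^ j) '' (s : Set L)) := by
    refine adjoin_le_iff.2 ?_
    rintro _ ⟨y, hy, rfl⟩
    change y ^ p ^ (j + 1) ∈ _
    rw [← hpp]
    exact pow_mem (subset_adjoin K _ (Set.mem_image_of_mem _ hy)) p
  rw [← sup_eq_right.2 hle, h s subset_rfl, ← hs.2, ← Finset.prod_const, ← Finset.prod_mul_distrib]
  refine Finset.prod_congr rfl fun x hx => ?_
  rw [finrank_adjoin_simple_eq_mul (p := p) (hrange x hx), hpp]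

/-- Sweedler's criterion: the extension is modular if `K` and `L ^ (p ^ j)` are linearly disjoint
over their intersection for all `j`. -/
theorem isModularExtension_of_mem_closure {e : ℕ} (he : ∀ x : L, x ^ p ^ e ∈ (algebraMap K L).range)
    (hdis : ∀ j, 0 < j → ∀ S : Set L, (∀ s ∈ S, s ∈ frobPow L p j) → ∀ x ∈ frobPow L p j,
      x ∈ Submodule.span K S → x ∈ AddSubmonoid.closure
        {w | ∃ c : K, algebraMap K L c ∈ frobPow L p j ∧ ∃ s ∈ S, algebraMap K L c * s = w}) :
    IsModularExtension K L := by
  classical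
  -- Climb from `K(L ^ p ^ e) = K` to `L`, taking `p`-th roots of the old generators and adding new
  -- ones at each level.
  have key (k : ℕ) (hk : k ≤ e) : ∃ s : Finset L, IsModularFamily K (p ^ (e - k)) s ∧
      adjoin K ((fun x => x ^ p ^ (e - k)) '' (s : Set L)) = powField K L (p ^ (e - k)) := by
    induction k with
    | zero =>
      refine ⟨∅, ⟨by simp, ?_⟩, by simp [powField_eq_bot he]⟩
      rw [Finset.coe_empty, Set.image_empty, adjoin_empty, IntermediateField.finrank_bot,
        Finset.prod_empty]
    | succ k ih =>
      obtain ⟨s, hs, hsM⟩ := ih (by omega)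
      generalize hj : e - (k + 1) = j
      have hjk : e - k = j + 1 := by omega
      rw [hjk] at hs hsM
      have hpp (y : L) : (y ^ p ^ j) ^ p = y ^ p ^ (j + 1) := by rw [← pow_mul, pow_succ]
      obtain ⟨t, hst, ht, hroot⟩ := hs.root.exists_superset
      refine ⟨t, ht, le_antisymm (adjoin.mono _ _ _ (Set.image_subset_range _ _)) ?_⟩
      set N := adjoin K ((fun x => x ^ p ^ j) '' (t : Set L))
      refine adjoin_le_iff.2 ?_
      rintro _ ⟨x, rfl⟩
      have hx : x ^ p ^ (j + 1) ∈ Submodule.span K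
          (Submonoid.closure ((fun x => x ^ p ^ (j + 1)) '' (s : Set L)) : Set L) := by
        rw [← Algebra.adjoin_eq_span, Subalgebra.mem_toSubmodule,
          ← adjoin_toSubalgebra_of_isAlgebraic fun _ _ => Algebra.IsAlgebraic.isAlgebraic _]
        exact hsM ▸ pow_mem_powField _ x
      have hS : ∀ y ∈ Submonoid.closure ((fun x => x ^ p ^ (j + 1)) '' (s : Set L)),
          y ∈ frobPow L p (j + 1) := by
        intro y hy
        refine (Submonoid.closure_le (S := (frobPow L p (j + 1)).toSubmonoid)).2 ?_ hy
        rintro _ ⟨y, -, rfl⟩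
        exact mem_frobPow.2 ⟨y, rfl⟩
      -- `R` is the ring of `p`-th powers of `N`. Disjointness allows coefficients `l ^ p ^ (j + 1)`
      -- lying in `K`, and `hroot` puts their roots `l ^ p ^ j` in `N`.
      let R : Subring L := N.toSubring.map (frobenius L p)
      have hR : x ^ p ^ (j + 1) ∈ R := by
        refine (AddSubmonoid.closure_le (S := R.toAddSubmonoid)).2 ?_
          (hdis (j + 1) j.succ_pos _ hS _ (mem_frobPow.2 ⟨x, rfl⟩) hx)
        rintro _ ⟨c, hc, y, hy, rfl⟩
        refine R.mul_mem ?_ ?_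
        · obtain ⟨l, hl⟩ := mem_frobPow.1 hc
          exact ⟨l ^ p ^ j, hroot l ⟨c, hl.symm⟩, (hpp l).trans hl⟩
        · refine (Submonoid.closure_le (S := R.toSubmonoid)).2 ?_ hy
          rintro _ ⟨y, hys, rfl⟩
          exact ⟨y ^ p ^ j, subset_adjoin K _ ⟨y, hst hys, rfl⟩, hpp y⟩
      obtain ⟨w, hw, hwx⟩ := hR
      have : w = x ^ p ^ j := frobenius_inj L p (hwx.trans (hpp x).symm)
      change x ^ p ^ j ∈ N
      rwa [← this]
  obtain ⟨s, hs, hsM⟩ := key e le_rfl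
  rw [Nat.sub_self, pow_zero] at hs hsM
  rw [powField_one] at hsM
  have hid : (fun x : L => x ^ 1) '' (s : Set L) = s := by simp
  refine (isModularExtension_iff K L).2 ⟨s.card, fun k => (s.equivFin.symm k : L), ?_, ?_⟩
  · rw [← hsM, hid]
    congr 1
    ext x
    refine ⟨fun ⟨k, hk⟩ => hk ▸ (s.equivFin.symm k).2, fun hx => ⟨s.equivFin ⟨x, hx⟩, by simp⟩⟩
  · have := hs.2
    rw [hsM, finrank_top'] at this
    rw [← this, ← Finset.prod_coe_sort s]
    refine (Equiv.prod_comp s.equivFin.symm fun x : s => finrank K K⟮(x : L)⟯).trans ?_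
    exact Finset.prod_congr rfl fun x _ => by rw [pow_one]

end Sweedler

/-! ### The converse and the main theorem -/

theorem isModularExtension_of_span_frobDiffOp {p : ℕ} [Fact p.Prime] {K L : Type*} [Field K]
    [Field L] [Algebra K L] [CharP K p] [CharP L p] [FiniteDimensional K L]
    [IsPurelyInseparable K L]
    (h : ∀ i : ℕ, 0 < i → i < IsPurelyInseparable.exponent K L →
      Submodule.span L (frobDiffOp K L p i : Set (diffOp K L (p ^ i))) = ⊤) :
    IsModularExtension K L := by
  have he := IsPurelyInseparable.exponent_def' K p (L := L)
  set e := IsPurelyInseparable.exponent K L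
  refine isModularExtension_of_mem_closure he fun j hj S hS x hx hxS => ?_
  let M : Subfield L := (iterateFrobenius L p j).fieldRange
  -- If `e ≤ j`, then `L ^ (p ^ j)` lies in `K` and no operators are needed. Otherwise `0 < j ≤ e -
  -- 1`, so the hypothesis applies at `e - 1` and those operators preserve `L ^ (p ^ j)`.
  by_cases hje : e ≤ j
  · refine mem_closure_of_mem_span (M := M) (𝒟 := ∅) (by simp) (fun y hy _ => ?_) hS hx hxS
    obtain ⟨a, rfl⟩ := mem_frobPow.1 (show y ∈ frobPow L p j from hy)
    rw [← Nat.add_sub_cancel' hje, pow_add, pow_mul]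
    exact pow_mem (he a) _
  · refine mem_closure_of_mem_span (M := M)
      (𝒟 := (fun D : diffOp K L (p ^ (e - 1)) => (D : L →ₗ[K] L)) '' frobDiffOp K L p (e - 1))
      ?_ (fun y _ hy => ?_) hS hx hxS
    · rintro _ ⟨D, hD, rfl⟩ y hy
      exact hD j (by omega) y hy
    · by_contra hyK
      obtain ⟨D, hD, hne⟩ := exists_diffOp_apply_ne he hyK
      have hD' : (⟨D, hD⟩ : diffOp K L (p ^ (e - 1))) ∈
          Submodule.span L (frobDiffOp K L p (e - 1) : Set (diffOp K L (p ^ (e - 1)))) := by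
        rw [h (e - 1) (by omega) (by omega)]
        exact Submodule.mem_top
      refine hne ?_
      -- Being constant at `y` is an `L`-linear condition on `E`, so it passes to the span.
      suffices H : ∀ E ∈ Submodule.span L (frobDiffOp K L p (e - 1) : Set (diffOp K L (p ^ (e - 1)))),
          (E : L →ₗ[K] L) y = (E : L →ₗ[K] L) 1 * y from H _ hD'
      intro E hE
      induction hE using Submodule.span_induction with
      | mem E hE => exact hy _ ⟨E, hE, rfl⟩
      | zero => simp
      | add E G _ _ hE hG => simp [hE, hG, add_mul]
      | smul c E _ hE => simp [hE, mul_assoc]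

theorem theorem4p2 (p : ℕ) [Fact p.Prime] (K L : Type*) [Field K] [Field L] [Algebra K L]
    [CharP K p] [CharP L p] [FiniteDimensional K L] [IsPurelyInseparable K L] :
    (IsModularExtension K L ↔
      ∀ i : ℕ, 0 < i → i < IsPurelyInseparable.exponent K L →
        Function.Surjective (frobDiffOpMul K L p i)) ∧
    ∀ i : ℕ, 0 < i → i < IsPurelyInseparable.exponent K L →
      (Function.Surjective (frobDiffOpMul K L p i) ↔
        Submodule.span L (frobDiffOp K L p i : Set (diffOp K L (p ^ i))) = ⊤) := by
  refine ⟨⟨fun h i _ _ => ?_, fun h => ?_⟩, fun i _ _ => frobDiffOpMul_surjective_iff K L p i⟩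
  · exact (frobDiffOpMul_surjective_iff K L p i).2 (h.span_frobDiffOp p K L i)
  · exact isModularExtension_of_span_frobDiffOp fun i hi hie =>
      (frobDiffOpMul_surjective_iff K L p i).1 (h i hi hie)
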